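/- Let $\kappa>0$. The improper integral $$f(\kappa)=-\int_0^\infty \frac{e^{-i\tau}}{\tau^3}\left[\sqrt{\kappa}\,\tau\,\mathrm{csch}(\sqrt{\kappa}\,\tau)-1+\frac{\kappa\tau^2}{6}\right]\mathrm{d}\tau = -\lim_{T\to\infty}\int_0^T \frac{e^{-i\tau}}{\tau^3}\left[\sqrt{\kappa}\,\tau\,\mathrm{csch}(\sqrt{\kappa}\,\tau)-1+\frac{\kappa\tau^2}{6}\right]\mathrm{d}\tau$$ (the electric Heisenberg–Euler integral for spin-$0$ particles) converges: the integrand is integrable on every $[0,T]$ and the limit exists. For $\nu=\frac{\sqrt{\kappa}+i}{2\sqrt{\kappa}}$ the series $\sum_{n\ge 0}(n+\nu)^{-s}$ (principal powers, $\mathrm{Re}\,s>1$) converges and has an analytic continuation $s\mapsto\zeta(s,\nu)$, the Hurwitz zeta function, to $\mathbb{C}\setminus\{1\}$. With $\zeta^{(1,0)}(s,\nu)=\partial_s\zeta(s,\nu)$, $$f(\kappa)=\frac{\kappa}{6}-\frac14-\left(\frac{\kappa}{6}+\frac12\right)\ln\left(2\sqrt{\kappa}\right)+i\left(\frac{\pi}{4}+\frac{\kappa\pi}{12}\right)+4\kappa\,\zeta^{(1,0)}\!\left(-1,\frac{\sqrt{\kappa}+i}{2\sqrt{\kappa}}\right).$$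 -/

import Mathlib

open Filter Topology MeasureTheory

namespace HeisenbergEuler

/-- The hyperbolic cosecant. -/
noncomputable def csch (x : ℝ) : ℝ := 1 / Real.sinh x

/-- The integrand `e^{-iτ} τ⁻³ (√κ τ csch (√κ τ) - 1 + κ τ² / 6)`. It extends continuously by `0`
to `τ = 0`, and it decays only like `1 / τ` as `τ → ∞`. -/
noncomputable def electricIntegrand (κ τ : ℝ) : ℂ :=
  Complex.exp (-Complex.I * (τ : ℂ)) / (τ : ℂ) ^ 3 *
    ((√κ * τ * csch (√κ * τ) - 1 + κ * τ ^ 2 / 6 : ℝ) : ℂ)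

/-- The improper integral `∫₀^∞ g` converges to `I`: `g` is integrable on every `[0, T]`, and
`∫₀^T g` tends to `I` as `T → ∞`. (Absolute integrability on `[0, ∞)` is not required.) -/
def HasImproperIntegral (g : ℝ → ℂ) (I : ℂ) : Prop :=
  (∀ T : ℝ, 0 ≤ T → IntervalIntegrable g volume 0 T) ∧
    Tendsto (fun T : ℝ => ∫ τ in (0 : ℝ)..T, g τ) atTop (𝓝 I)

/-- The value of the improper integral `∫₀^∞ g`; it is meaningful when `HasImproperIntegral g I`
holds for some `I`, and it is then that `I`. -/
noncomputable def improperIntegral (g : ℝ → ℂ) : ℂ :=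
  limUnder atTop (fun T : ℝ => ∫ τ in (0 : ℝ)..T, g τ)

theorem HasImproperIntegral.improperIntegral_eq {g : ℝ → ℂ} {I : ℂ}
    (h : HasImproperIntegral g I) : improperIntegral g = I :=
  h.2.limUnder_eq

/-- The electric Heisenberg–Euler integral
`f(κ) = -∫₀^∞ e^{-iτ} τ⁻³ (√κ τ csch (√κ τ) - 1 + κ τ² / 6) dτ`. -/
noncomputable def electricF (κ : ℝ) : ℂ :=
  -improperIntegral (electricIntegrand κ)

/-- `Z` is the analytic continuation to `ℂ ∖ {1}` of the Hurwitz series `∑ (n + ν)^{-s}`, `Re s > 1`,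
the powers being principal ones. The value of `Z` at the pole `1` is irrelevant. -/
def IsHurwitzZeta (ν : ℂ) (Z : ℂ → ℂ) : Prop :=
  DifferentiableOn ℂ Z {1}ᶜ ∧
    ∀ s : ℂ, 1 < s.re → HasSum (fun n : ℕ => ((n : ℂ) + ν) ^ (-s)) (Z s)

/-- The analytic continuation is unique. -/
theorem IsHurwitzZeta.eqOn {ν : ℂ} {Z W : ℂ → ℂ} (hZ : IsHurwitzZeta ν Z)
    (hW : IsHurwitzZeta ν W) : Set.EqOn Z W {1}ᶜ := by
  have ho : IsOpen ({1}ᶜ : Set ℂ) := isOpen_compl_singleton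
  have hc : IsPreconnected ({1}ᶜ : Set ℂ) :=
    (isConnected_compl_singleton_of_one_lt_rank (by simp) 1).isPreconnected
  refine (hZ.1.analyticOnNhd ho).eqOn_of_preconnected_of_eventuallyEq
    (hW.1.analyticOnNhd ho) hc (z₀ := 2) (by simp) ?_
  have hmem : {s : ℂ | 1 < s.re} ∈ 𝓝 (2 : ℂ) :=
    (isOpen_lt continuous_const Complex.continuous_re).mem_nhds (by simp)
  filter_upwards [hmem] with s hs
  exact (hZ.2 s hs).unique (hW.2 s hs)

open Classical in
/-- The Hurwitz zeta function `ζ(s, ν)` with complex second argument: the analytic continuation in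
`s` of `∑ (n + ν)^{-s}` (and `0` for those `ν` for which there is none). -/
noncomputable def hurwitzZeta (s ν : ℂ) : ℂ :=
  if h : ∃ Z, IsHurwitzZeta ν Z then h.choose s else 0

/-- `ζ^{(1,0)}(s, ν)`, the derivative of the Hurwitz zeta function in its first argument. -/
noncomputable def hurwitzZetaDeriv (s ν : ℂ) : ℂ :=
  deriv (fun z => hurwitzZeta z ν) s

end HeisenbergEuler

/-!
Put `z = i / (2 √κ)`, so that the second argument of the zeta function is `ν = z + 1/2`, with real
part `1/2`. After the substitution `u = 2 √κ τ` the theorem compares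
`∫₀^∞ e^{-zu} u⁻² (1 / (2 sinh (u/2)) - 1/u + u/24) du` with `∂ₛ ζ(-1, ν)`.

For `Re s > 1` one has `Γ(s) ζ(s, ν) = ∫₀^∞ u^{s-1} e^{-νu} / (1 - e⁻ᵘ) du`. Subtracting from
`1 / (1 - e⁻ᵘ)` the first `K` terms `c k u^{k-1}` of its expansion at `0`, with the factor `e^{-νu}`
kept, makes the Mellin integral converge for `Re s > 1 - K`, while the subtracted terms contribute
multiples of `ν^{1-s-k} Γ(s-1+k)` (`hasMellin_toddRem`). Letting `K` grow continues `ζ(s, ν)` to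
`ℂ ∖ {1}` (`exists_isHurwitzZeta`). With `K = 3` the point `s = -1` is reached, and because
`1 / Γ` has a simple zero there, `∂ₛ ζ(-1, ν)` is minus the Mellin integral at `-1` plus
elementary terms in `ν` (`hurwitzZetaDeriv_neg_one`).

The integral of the theorem subtracts `e^{-zu} (1/u - u/24)` in place of
`e^{-νu} (1/u + 1/2 + u/12)`, and this is what spoils absolute convergence, as `Re z = 0`. Divided by
`u²`, the difference of the two equals `∫₀^{1/2} (t²/2 - 1/24) e^{-(z+t)u} dt` (`oscillatoryPart_eq`).
By Fubini its integral over `[0, T]` is `∫₀^{1/2} (t²/2 - 1/24) (1 - e^{-(z+t)T}) / (z+t) dt`, which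
tends to `∫₀^{1/2} (t²/2 - 1/24) / (z+t) dt` by dominated convergence
(`tendsto_integral_oscillatoryPart`), and this last integral is elementary. So the conditionally
convergent part is computed in closed form, and no Abel summation or limit in `ν` is needed.
-/

namespace HeisenbergEuler

open Set Asymptotics

/-! ### The Mellin transform of a complex exponential -/

theorem norm_cexp_neg_mul_ofReal (w : ℂ) (t : ℝ) :
    ‖Complex.exp (-w * t)‖ = Real.exp (-w.re * t) := by
  simp [Complex.norm_exp]

theorem mellinConvergent_cexp {w a : ℂ} (hw : 0 < w.re) (ha : 0 < a.re) :
    MellinConvergent (fun t : ℝ => Complex.exp (-w * t)) a := by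
  refine mellinConvergent_of_isBigO_rpow_exp (a := w.re) (b := 0) hw
    ((Continuous.locallyIntegrable (by fun_prop)).locallyIntegrableOn _) ?_ ?_ ha
  · exact isBigO_of_le _ fun t => by
      rw [norm_cexp_neg_mul_ofReal, Real.norm_of_nonneg (Real.exp_pos _).le]
  · simp only [neg_zero, Real.rpow_zero]
    have : ContinuousAt (fun t : ℝ => Complex.exp (-w * t)) 0 := by fun_prop
    exact (this.isBigO_one ℝ).mono nhdsWithin_le_nhds

theorem differentiableAt_mellin_cexp {w a : ℂ} (hw : 0 < w.re) (ha : 0 < a.re) :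
    DifferentiableAt ℂ (fun v : ℂ => mellin (fun t : ℝ => Complex.exp (-v * t)) a) w := by
  have hw2 : 0 < w.re / 2 := by positivity
  have hb : Integrable (fun t : ℝ => ‖(t : ℂ) ^ (a + 1 - 1) •
      Complex.exp (-((w.re / 2 : ℝ) : ℂ) * t)‖) (volume.restrict (Ioi 0)) := by
    have := mellinConvergent_cexp (w := ((w.re / 2 : ℝ) : ℂ)) (a := a + 1)
      (by simpa using hw2) (by simp; positivity)
    exact Integrable.norm this
  have hcont : ∀ v : ℂ, ContinuousOn (fun t : ℝ => (t : ℂ) ^ (a - 1) • Complex.exp (-v * t))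
      (Ioi 0) := by
    intro v t ht
    refine ContinuousAt.continuousWithinAt ?_
    have : ContinuousAt (fun t : ℝ => (t : ℂ) ^ (a - 1)) t :=
      Complex.continuousAt_ofReal_cpow_const _ _ (Or.inr (ne_of_gt ht))
    exact this.smul (by fun_prop)
  have key := hasDerivAt_integral_of_dominated_loc_of_deriv_le
    (μ := volume.restrict (Ioi (0 : ℝ)))
    (F := fun (v : ℂ) (t : ℝ) => (t : ℂ) ^ (a - 1) • Complex.exp (-v * t))
    (F' := fun (v : ℂ) (t : ℝ) => (t : ℂ) ^ (a - 1) • (Complex.exp (-v * t) * (-1 * t)))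
    (x₀ := w) (s := {v : ℂ | w.re / 2 < v.re})
    (bound := fun t : ℝ => ‖(t : ℂ) ^ (a + 1 - 1) • Complex.exp (-((w.re / 2 : ℝ) : ℂ) * t)‖)
    ((isOpen_lt continuous_const Complex.continuous_re).mem_nhds (by simp; linarith))
    (Eventually.of_forall fun v => (hcont v).aestronglyMeasurable measurableSet_Ioi)
    (mellinConvergent_cexp hw ha) ?_ ?_ hb ?_
  · exact key.2.differentiableAt
  · refine ContinuousOn.aestronglyMeasurable ?_ measurableSet_Ioi
    have := (hcont w).mul (f := fun t : ℝ => (t : ℂ) ^ (a - 1) • Complex.exp (-w * t))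
      (g := fun t : ℝ => (-1 * t : ℂ)) (by fun_prop)
    refine this.congr fun t _ => ?_
    simp [mul_assoc]
  · filter_upwards [ae_restrict_mem measurableSet_Ioi] with t ht v hv
    have ht' : (0 : ℝ) < t := ht
    have hv' : w.re / 2 < v.re := hv
    rw [norm_smul, norm_mul, norm_smul, norm_cexp_neg_mul_ofReal, norm_cexp_neg_mul_ofReal,
      Complex.norm_cpow_eq_rpow_re_of_pos ht', Complex.norm_cpow_eq_rpow_re_of_pos ht']
    have h1 : ‖(-1 * t : ℂ)‖ = t := by simp [abs_of_pos ht']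
    have h2 : t ^ (a + 1 - 1).re = t ^ (a - 1).re * t := by
      rw [← Real.rpow_add_one ht'.ne']; congr 1; simp
    rw [h1, h2, Complex.ofReal_re]
    have h3 : Real.exp (-v.re * t) ≤ Real.exp (-(w.re / 2) * t) := by
      apply Real.exp_le_exp.2; nlinarith
    have h4 : 0 ≤ t ^ (a - 1).re * t := by positivity
    nlinarith [mul_le_mul_of_nonneg_left h3 h4]
  · filter_upwards [ae_restrict_mem measurableSet_Ioi] with t _ v _
    have : HasDerivAt (fun v : ℂ => -v * (t : ℂ)) (-1 * t) v :=
      ((hasDerivAt_id v).neg).mul_const _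
    exact this.cexp.const_smul ((t : ℂ) ^ (a - 1))

/-- Mathlib has this for real `w`; both sides are analytic in `w` on the right half plane. -/
theorem mellin_cexp {w a : ℂ} (hw : 0 < w.re) (ha : 0 < a.re) :
    mellin (fun t : ℝ => Complex.exp (-w * t)) a = w ^ (-a) * Complex.Gamma a := by
  have hopen : IsOpen {v : ℂ | 0 < v.re} := isOpen_lt continuous_const Complex.continuous_re
  have hpre : IsPreconnected {v : ℂ | 0 < v.re} := (convex_halfSpace_re_gt 0).isPreconnected
  have hL : DifferentiableOn ℂ (fun v : ℂ => mellin (fun t : ℝ => Complex.exp (-v * t)) a)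
      {v : ℂ | 0 < v.re} := fun v hv => (differentiableAt_mellin_cexp hv ha).differentiableWithinAt
  have hR : DifferentiableOn ℂ (fun v : ℂ => v ^ (-a) * Complex.Gamma a) {v : ℂ | 0 < v.re} :=
    fun v hv => (((differentiableAt_id).cpow_const (Or.inl hv)).mul_const _).differentiableWithinAt
  refine (hL.analyticOnNhd hopen).eqOn_of_preconnected_of_frequently_eq
    (hR.analyticOnNhd hopen) hpre (z₀ := 1) (by simp) ?_ hw
  have hseq : Tendsto (fun r : ℝ => (r : ℂ)) (𝓝[>] 1) (𝓝[≠] 1) := by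
    refine tendsto_nhdsWithin_iff.2 ⟨?_, ?_⟩
    · exact (Complex.continuous_ofReal.tendsto' 1 1 (by simp)).mono_left nhdsWithin_le_nhds
    · filter_upwards [self_mem_nhdsWithin] with r hr
      have : (1 : ℝ) < r := hr
      simpa using this.ne'
  refine hseq.frequently (Eventually.frequently ?_)
  filter_upwards [self_mem_nhdsWithin] with r hr
  have hr0 : (0 : ℝ) < r := lt_trans one_pos hr
  have := Complex.integral_cpow_mul_exp_neg_mul_Ioi ha hr0
  rw [one_div, Complex.inv_cpow _ _ (by
    rw [Complex.arg_ofReal_of_nonneg hr0.le]; exact Real.pi_pos.ne), ← Complex.cpow_neg] at this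
  rw [← this, mellin]
  simp [neg_mul]

/-! ### The generating function `u / (1 - e⁻ᵘ)` -/

/-- The Todd function `u / (1 - e⁻ᵘ)` of a real variable (with the junk value `0` at `0`, which is
never used). -/
noncomputable def todd (u : ℝ) : ℝ := u / (1 - Real.exp (-u))

theorem one_sub_exp_neg_pos {u : ℝ} (hu : 0 < u) : 0 < 1 - Real.exp (-u) := by
  have : Real.exp (-u) < 1 := Real.exp_lt_one_iff.2 (by linarith)
  linarith

theorem todd_nonneg {u : ℝ} (hu : 0 < u) : 0 ≤ todd u :=
  div_nonneg hu.le (one_sub_exp_neg_pos hu).le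

theorem todd_le {u : ℝ} (hu : 0 < u) : todd u ≤ 1 + u := by
  rw [todd, div_le_iff₀ (one_sub_exp_neg_pos hu)]
  have h1 : (1 + u) * Real.exp (-u) ≤ 1 := by
    have := Real.add_one_le_exp u
    calc (1 + u) * Real.exp (-u) ≤ Real.exp u * Real.exp (-u) := by gcongr; linarith
      _ = 1 := by rw [← Real.exp_add]; simp
  linarith

theorem todd_isBigO_one : todd =O[𝓝[>] 0] fun _ => (1 : ℝ) := by
  refine IsBigO.of_bound 2 ?_
  filter_upwards [Ioo_mem_nhdsGT (zero_lt_one' ℝ)] with u hu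
  rw [Real.norm_of_nonneg (todd_nonneg hu.1), norm_one]
  linarith [todd_le hu.1, hu.2]

theorem continuousOn_todd : ContinuousOn todd (Ioi 0) := by
  refine continuousOn_id.div (by fun_prop) fun u hu => (one_sub_exp_neg_pos hu).ne'

/-- The Todd function has an asymptotic expansion in powers of `u` to every order at `0`. -/
theorem exists_todd_sub_sum_isBigO (K : ℕ) : ∃ c : ℕ → ℝ,
    (fun u => todd u - ∑ k ∈ Finset.range K, c k * u ^ k) =O[𝓝[>] 0] fun u => u ^ K := by
  have hexp : AnalyticAt ℝ (fun u : ℝ => -Real.exp (-u)) 0 := by fun_prop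
  obtain ⟨p, hp⟩ := hexp
  have hds : AnalyticAt ℝ (dslope (fun u : ℝ => -Real.exp (-u)) 0) 0 :=
    ⟨_, hp.has_fpower_series_dslope_fslope⟩
  have hder : HasDerivAt (fun u : ℝ => -Real.exp (-u)) 1 0 := by
    have := ((hasDerivAt_neg (0 : ℝ)).exp).fun_neg
    simpa using this
  have hne : dslope (fun u : ℝ => -Real.exp (-u)) 0 0 ≠ 0 := by
    rw [dslope_same, hder.deriv]; exact one_ne_zero
  -- the Todd function is the reciprocal of the difference quotient of `-e⁻ᵘ` at `0`
  obtain ⟨q, hq⟩ := hds.inv hne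
  refine ⟨q.coeff, ?_⟩
  refine ((hq.isBigO_sub_partialSum_pow K).mono nhdsWithin_le_nhds).congr' ?_ ?_
  · filter_upwards [self_mem_nhdsWithin] with u hu
    have hu' : (0 : ℝ) < u := hu
    congr 1
    · rw [zero_add, Pi.inv_apply, dslope_of_ne _ hu'.ne', slope_def_field, todd, inv_div]
      congr 1 <;> simp; ring
    · rw [FormalMultilinearSeries.partialSum]
      refine Finset.sum_congr rfl fun k _ => ?_
      rw [FormalMultilinearSeries.apply_eq_pow_smul_coeff, smul_eq_mul, mul_comm]
  · filter_upwards [self_mem_nhdsWithin] with u hu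
    rw [Real.norm_of_nonneg (le_of_lt hu)]

/-- The first coefficients `1, 1/2, 1/12` of the Todd function. -/
noncomputable def toddCoeff : ℕ → ℝ
  | 0 => 1
  | 1 => 1 / 2
  | 2 => 1 / 12
  | _ => 0

theorem sum_toddCoeff (u : ℝ) :
    ∑ k ∈ Finset.range 3, toddCoeff k * u ^ k = 1 + u / 2 + u ^ 2 / 12 := by
  simp [Finset.sum_range_succ, toddCoeff]; ring

theorem todd_sub_sum_toddCoeff_isBigO :
    (fun u => todd u - ∑ k ∈ Finset.range 3, toddCoeff k * u ^ k) =O[𝓝[>] 0] fun u => u ^ 3 := by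
  have hE : (fun u : ℝ => Real.exp (-u) - (1 - u + u ^ 2 / 2 - u ^ 3 / 6)) =O[𝓝[>] 0]
      fun u => u ^ 4 := by
    have h := (Real.exp_sub_sum_range_isBigO_pow 4).comp_tendsto
      (k := fun u : ℝ => -u) (l' := 𝓝[>] 0)
      ((continuous_neg.tendsto' (0 : ℝ) 0 (by simp)).mono_left nhdsWithin_le_nhds)
    refine h.congr (fun u => ?_) (fun u => ?_)
    · simp [Finset.sum_range_succ, Nat.factorial]; ring
    · simp only [Function.comp]; ring
  -- `u - (1 - e⁻ᵘ) (1 + u / 2 + u² / 12)` vanishes to order `4`, ...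
  have hnum : (fun u : ℝ => u - (1 - Real.exp (-u)) * (1 + u / 2 + u ^ 2 / 12)) =O[𝓝[>] 0]
      fun u => u ^ 4 := by
    have hbdd : (fun u : ℝ => 1 + u / 2 + u ^ 2 / 12) =O[𝓝[>] 0] fun _ => (1 : ℝ) := by
      have : ContinuousAt (fun u : ℝ => 1 + u / 2 + u ^ 2 / 12) 0 := by fun_prop
      exact (this.isBigO_one ℝ).mono nhdsWithin_le_nhds
    have hbdd2 : (fun u : ℝ => -1 / 24 - u / 72) =O[𝓝[>] 0] fun _ => (1 : ℝ) := by
      have : ContinuousAt (fun u : ℝ => -1 / 24 - u / 72) 0 := by fun_prop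
      exact (this.isBigO_one ℝ).mono nhdsWithin_le_nhds
    have h1 := (hE.mul hbdd).add ((isBigO_refl (fun u : ℝ => u ^ 4) _).mul hbdd2)
    refine (h1.congr_left fun u => ?_).trans (isBigO_of_le _ fun u => by simp)
    ring
  -- ... and `todd u - (1 + u / 2 + u² / 12)` is its quotient by `1 - e⁻ᵘ = u / todd u`.
  have h2 := (hnum.mul todd_isBigO_one).mul (isBigO_refl (fun u : ℝ => u⁻¹) (𝓝[>] 0))
  refine h2.congr' ?_ ?_
  · filter_upwards [self_mem_nhdsWithin] with u hu
    have hu' : (0 : ℝ) < u := hu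
    have := (one_sub_exp_neg_pos hu').ne'
    rw [sum_toddCoeff, todd]
    field_simp
  · filter_upwards [self_mem_nhdsWithin] with u hu
    have hu' : u ≠ 0 := ne_of_gt hu
    field_simp

/-! ### Mellin transform of the subtracted generating function -/

/-- `e^{-νu} / (1 - e⁻ᵘ)` minus `e^{-νu}` times the first `K` terms of the expansion
`∑ c k u^(k - 1)` of `1 / (1 - e⁻ᵘ)` at `0`. -/
noncomputable def toddRem (c : ℕ → ℝ) (K : ℕ) (ν : ℂ) (u : ℝ) : ℂ :=
  Complex.exp (-ν * u) *
    (((todd u - ∑ k ∈ Finset.range K, c k * u ^ k) / u : ℝ) : ℂ)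

theorem continuousOn_toddRem (c : ℕ → ℝ) (K : ℕ) (ν : ℂ) :
    ContinuousOn (toddRem c K ν) (Ioi 0) := by
  refine ContinuousOn.mul (by fun_prop) (Complex.continuous_ofReal.comp_continuousOn ?_)
  refine ContinuousOn.div ?_ continuousOn_id fun u hu => ne_of_gt hu
  exact continuousOn_todd.sub (by fun_prop)

theorem toddRem_isBigO_atTop (c : ℕ → ℝ) (K : ℕ) {ν : ℂ} (hν : 0 < ν.re) :
    toddRem c K ν =O[atTop] fun u : ℝ => Real.exp (-(ν.re / 2) * u) := by
  have hε : 0 < ν.re / 2 := by positivity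
  have hpow : ∀ k : ℕ, (fun u : ℝ => u ^ k) =O[atTop] fun u => Real.exp (ν.re / 2 * u) :=
    fun k => (isLittleO_pow_exp_pos_mul_atTop k hε).isBigO
  have htodd : todd =O[atTop] fun u => Real.exp (ν.re / 2 * u) := by
    refine IsBigO.trans (IsBigO.of_bound 1 ?_) ((hpow 0).add (hpow 1))
    filter_upwards [eventually_gt_atTop 0] with u hu
    rw [Real.norm_of_nonneg (todd_nonneg hu), one_mul]
    exact (todd_le hu).trans ((le_abs_self _).trans_eq' (by simp))
  have hsum : (fun u : ℝ => todd u - ∑ k ∈ Finset.range K, c k * u ^ k) =O[atTop]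
      fun u => Real.exp (ν.re / 2 * u) :=
    htodd.sub (IsBigO.fun_sum fun k _ => (hpow k).const_mul_left _)
  have hinv : (fun u : ℝ => u⁻¹) =O[atTop] fun _ => (1 : ℝ) :=
    tendsto_inv_atTop_zero.isBigO_one ℝ
  have hexp : (fun u : ℝ => Complex.exp (-ν * u)) =O[atTop] fun u => Real.exp (-ν.re * u) :=
    isBigO_of_le _ fun u => by
      rw [norm_cexp_neg_mul_ofReal, Real.norm_of_nonneg (Real.exp_pos _).le]
  have h2 : (fun u : ℝ => (((todd u - ∑ k ∈ Finset.range K, c k * u ^ k) / u : ℝ) : ℂ)) =O[atTop]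
      fun u => Real.exp (ν.re / 2 * u) := by
    refine IsBigO.of_norm_left ?_
    simp only [Complex.norm_real]
    refine ((hsum.mul hinv).norm_left).congr (fun u => ?_) (fun u => by simp)
    rw [div_eq_mul_inv]
  refine (hexp.mul h2).congr_right fun u => ?_
  rw [← Real.exp_add]; congr 1; ring

theorem toddRem_isBigO_zero {c : ℕ → ℝ} {K : ℕ} (ν : ℂ)
    (hc : (fun u => todd u - ∑ k ∈ Finset.range K, c k * u ^ k) =O[𝓝[>] 0] fun u => u ^ K) :
    toddRem c K ν =O[𝓝[>] 0] fun u : ℝ => u ^ (-(1 - K : ℝ)) := by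
  have hexp : (fun u : ℝ => Complex.exp (-ν * u)) =O[𝓝[>] 0] fun _ => (1 : ℝ) := by
    have : ContinuousAt (fun u : ℝ => Complex.exp (-ν * u)) 0 := by fun_prop
    exact (this.isBigO_one ℝ).mono nhdsWithin_le_nhds
  have h2 : (fun u : ℝ => (((todd u - ∑ k ∈ Finset.range K, c k * u ^ k) / u : ℝ) : ℂ))
      =O[𝓝[>] 0] fun u : ℝ => u ^ K * u⁻¹ := by
    refine IsBigO.of_norm_left ?_
    simp only [Complex.norm_real, div_eq_mul_inv]
    exact (hc.mul (isBigO_refl (fun u : ℝ => u⁻¹) _)).norm_left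
  refine (hexp.mul h2).congr' EventuallyEq.rfl ?_
  filter_upwards [self_mem_nhdsWithin] with u hu
  have hu' : (0 : ℝ) < u := hu
  rw [one_mul, neg_sub, Real.rpow_sub_one hu'.ne', Real.rpow_natCast, div_eq_mul_inv]

theorem mellinConvergent_toddRem {c : ℕ → ℝ} {K : ℕ} {ν s : ℂ} (hν : 0 < ν.re)
    (hc : (fun u => todd u - ∑ k ∈ Finset.range K, c k * u ^ k) =O[𝓝[>] 0] fun u => u ^ K)
    (hs : 1 - K < s.re) : MellinConvergent (toddRem c K ν) s :=
  mellinConvergent_of_isBigO_rpow_exp (half_pos hν)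
    ((continuousOn_toddRem c K ν).locallyIntegrableOn measurableSet_Ioi)
    (toddRem_isBigO_atTop c K hν) (toddRem_isBigO_zero ν hc) hs

theorem differentiableAt_mellin_toddRem {c : ℕ → ℝ} {K : ℕ} {ν s : ℂ} (hν : 0 < ν.re)
    (hc : (fun u => todd u - ∑ k ∈ Finset.range K, c k * u ^ k) =O[𝓝[>] 0] fun u => u ^ K)
    (hs : 1 - K < s.re) : DifferentiableAt ℂ (mellin (toddRem c K ν)) s :=
  mellin_differentiableAt_of_isBigO_rpow_exp (half_pos hν)
    ((continuousOn_toddRem c K ν).locallyIntegrableOn measurableSet_Ioi)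
    (toddRem_isBigO_atTop c K hν) (toddRem_isBigO_zero ν hc) hs

/-- Without subtraction, the Mellin transform is `Γ(s)` times the Hurwitz series: expand
`1 / (1 - e⁻ᵘ)` into a geometric series and integrate termwise. -/
theorem hasSum_mellin_toddRem_zero (c : ℕ → ℝ) {ν s : ℂ} (hν : 0 < ν.re) (hs : 1 < s.re) :
    HasSum (fun n : ℕ => ((n : ℂ) + ν) ^ (-s) * Complex.Gamma s) (mellin (toddRem c 0 ν) s) := by
  have hs0 : 0 < s.re := one_pos.trans hs
  have hre : ∀ n : ℕ, 0 < ((n : ℂ) + ν).re := fun n => by simp; positivity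
  have hnorm : ∀ n : ℕ, ∫ u in Ioi (0 : ℝ), ‖(u : ℂ) ^ (s - 1) • Complex.exp (-((n : ℂ) + ν) * u)‖
      = (n + ν.re) ^ (-s.re) * Real.Gamma s.re := by
    intro n
    have hn : 0 < n + ν.re := by positivity
    have := Real.integral_rpow_mul_exp_neg_mul_Ioi hs0 hn
    rw [one_div, Real.inv_rpow hn.le, ← Real.rpow_neg hn.le] at this
    rw [← this]
    refine setIntegral_congr_fun measurableSet_Ioi fun u hu => ?_
    simp only [norm_smul]
    rw [norm_cexp_neg_mul_ofReal, Complex.norm_cpow_eq_rpow_re_of_pos hu]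
    rw [neg_mul, Complex.sub_re, Complex.one_re, Complex.add_re, Complex.natCast_re]
  have key := hasSum_integral_of_summable_integral_norm (μ := volume.restrict (Ioi (0 : ℝ)))
    (F := fun (n : ℕ) (u : ℝ) => (u : ℂ) ^ (s - 1) • Complex.exp (-((n : ℂ) + ν) * u))
    (fun n => mellinConvergent_cexp (hre n) hs0) ?_
  · have hval : ∫ u in Ioi (0 : ℝ), ∑' n : ℕ,
        (u : ℂ) ^ (s - 1) • Complex.exp (-((n : ℂ) + ν) * u) = mellin (toddRem c 0 ν) s := by
      refine setIntegral_congr_fun measurableSet_Ioi fun u hu => ?_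
      have hu' : (0 : ℝ) < u := hu
      have hlt : ‖Complex.exp (-(u : ℂ))‖ < 1 := by
        rw [Complex.norm_exp]; simpa using hu'
      have hgeom := (hasSum_geometric_of_norm_lt_one hlt).mul_left
        ((u : ℂ) ^ (s - 1) * Complex.exp (-ν * u))
      have hne : (1 : ℂ) - Complex.exp (-(u : ℂ)) ≠ 0 := by
        have := (one_sub_exp_neg_pos hu').ne'
        exact_mod_cast this
      have huc : (u : ℂ) ≠ 0 := by exact_mod_cast hu'.ne'
      convert hgeom.tsum_eq using 1
      · refine tsum_congr fun n => ?_
        rw [smul_eq_mul, mul_assoc, ← Complex.exp_nat_mul, ← Complex.exp_add]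
        congr 2; ring
      · simp only [toddRem, todd, Finset.range_zero, Finset.sum_empty, sub_zero, smul_eq_mul]
        push_cast
        field_simp
    rw [hval] at key
    exact (funext fun n => mellin_cexp (hre n) hs0 :) ▸ key
  · simp only [hnorm]
    refine Summable.mul_right _ (((Real.summable_one_div_nat_add_rpow ν.re s.re).2 hs).congr
      fun n => ?_)
    have hn : 0 < n + ν.re := by positivity
    rw [abs_of_pos hn, Real.rpow_neg hn.le, one_div]

/-- Subtracting `K` terms changes the Mellin transform by explicit Gamma factors. -/
theorem hasMellin_toddRem (c : ℕ → ℝ) (K : ℕ) {ν s : ℂ} (hν : 0 < ν.re) (hs : 1 < s.re) :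
    HasMellin (toddRem c K ν) s (mellin (toddRem c 0 ν) s -
      ∑ k ∈ Finset.range K, (c k : ℂ) * (ν ^ (1 - s - k) * Complex.Gamma (s - 1 + k))) := by
  induction K with
  | zero =>
    refine ⟨mellinConvergent_toddRem hν ?_ (by simpa using hs), by simp⟩
    simpa using todd_isBigO_one
  | succ K ih =>
    have hre : 0 < (s - 1 + K).re := by
      have : (0 : ℝ) ≤ K := K.cast_nonneg
      simp; linarith
    have hc := mellinConvergent_cexp hν hre
    have hint : IntegrableOn (fun u : ℝ => (c K : ℂ) * ((u : ℂ) ^ (s - 1 + K - 1) •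
      Complex.exp (-ν * u))) (Ioi 0) := Integrable.const_mul hc _
    have heq : EqOn (fun u : ℝ => (u : ℂ) ^ (s - 1) • toddRem c K ν u - (c K : ℂ) *
        ((u : ℂ) ^ (s - 1 + K - 1) • Complex.exp (-ν * u)))
        (fun u : ℝ => (u : ℂ) ^ (s - 1) • toddRem c (K + 1) ν u) (Ioi 0) := by
      intro u hu
      have huc : (u : ℂ) ≠ 0 := by exact_mod_cast ne_of_gt (show (0 : ℝ) < u from hu)
      have hp : (u : ℂ) ^ (s - 1 + K - 1) = (u : ℂ) ^ (s - 1) * (u : ℂ) ^ K / u := by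
        rw [Complex.cpow_sub _ _ huc, Complex.cpow_add _ _ huc, Complex.cpow_natCast,
          Complex.cpow_one]
      simp only [toddRem, smul_eq_mul, Finset.sum_range_succ, hp]
      push_cast
      field_simp
      ring
    refine ⟨IntegrableOn.congr_fun (Integrable.sub ih.1 hint) heq measurableSet_Ioi, ?_⟩
    rw [mellin, ← setIntegral_congr_fun measurableSet_Ioi heq, integral_sub ih.1 hint,
      integral_const_mul, Finset.sum_range_succ, ← sub_sub, ← ih.2, mellin]
    congr 2
    have := mellin_cexp hν hre
    rw [mellin] at this
    rw [this]
    congr 2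
    ring

/-! ### Analytic continuation of the Hurwitz zeta function -/

/-- The function `(s - 1) ζ(s, ν)`, continued to the half plane `1 - K < Re s`. The factor `s - 1`
removes the pole, so that the half plane, rather than a punctured one, is the domain. -/
noncomputable def hurwitzReg (c : ℕ → ℝ) (K : ℕ) (ν s : ℂ) : ℂ :=
  (s - 1) * ((Complex.Gamma s)⁻¹ * mellin (toddRem c K ν) s) +
    ∑ k ∈ Finset.range K, (c k : ℂ) * ((ascPochhammer ℂ k).eval (s - 1) * ν ^ (1 - s - k))

theorem differentiableOn_hurwitzReg {c : ℕ → ℝ} {K : ℕ} {ν : ℂ} (hν : 0 < ν.re)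
    (hc : (fun u => todd u - ∑ k ∈ Finset.range K, c k * u ^ k) =O[𝓝[>] 0] fun u => u ^ K) :
    DifferentiableOn ℂ (hurwitzReg c K ν) {s : ℂ | 1 - (K : ℝ) < s.re} := by
  have hν0 : ν ≠ 0 := by rintro rfl; simp at hν
  intro s hs
  refine DifferentiableAt.differentiableWithinAt ?_
  refine DifferentiableAt.add (DifferentiableAt.mul (by fun_prop)
    ((Complex.differentiable_one_div_Gamma s).mul (differentiableAt_mellin_toddRem hν hc hs))) ?_
  refine DifferentiableAt.fun_sum fun k _ => DifferentiableAt.const_mul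
    (DifferentiableAt.mul ?_ ?_) _
  · exact ((ascPochhammer ℂ k).differentiable (s - 1)).comp s (f := fun s => s - 1) (by fun_prop)
  · exact DifferentiableAt.const_cpow (by fun_prop) (Or.inl hν0)

theorem hasSum_hurwitzReg (c : ℕ → ℝ) (K : ℕ) {ν s : ℂ} (hν : 0 < ν.re) (hs : 1 < s.re) :
    HasSum (fun n : ℕ => ((n : ℂ) + ν) ^ (-s)) (hurwitzReg c K ν s / (s - 1)) := by
  have hs0 : 0 < s.re := one_pos.trans hs
  have hs1 : s - 1 ≠ 0 := fun h => by
    have := congrArg Complex.re h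
    simp at this; linarith
  have hΓ : Complex.Gamma s ≠ 0 := Complex.Gamma_ne_zero_of_re_pos hs0
  have hΓ1 : Complex.Gamma (s - 1) ≠ 0 :=
    Complex.Gamma_ne_zero_of_re_pos (by simpa using hs)
  have hrec : Complex.Gamma s = (s - 1) * Complex.Gamma (s - 1) := by
    have := Complex.Gamma_add_one (s - 1) hs1
    rwa [sub_add_cancel] at this
  have hpoch : ∀ k : ℕ, (ascPochhammer ℂ k).eval (s - 1) =
      Complex.Gamma (s - 1 + k) / Complex.Gamma (s - 1) := fun k => by
    refine (Complex.Gamma_add_nat_div_Gamma_eq (s - 1) fun m h => ?_).symm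
    have := congrArg Complex.re h
    have hm : (0 : ℝ) ≤ m := m.cast_nonneg
    simp at this; linarith
  have h := (hasSum_mellin_toddRem_zero c hν hs).mul_right (Complex.Gamma s)⁻¹
  simp only [mul_inv_cancel_right₀ hΓ] at h
  have hval : hurwitzReg c K ν s / (s - 1) =
      mellin (toddRem c 0 ν) s * (Complex.Gamma s)⁻¹ := by
    rw [hurwitzReg, (hasMellin_toddRem c K hν hs).2, add_div, mul_div_cancel_left₀ _ hs1,
      mul_sub, mul_comm _ (Complex.Gamma s)⁻¹, sub_add, sub_eq_self, sub_eq_zero, Finset.mul_sum,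
      Finset.sum_div]
    refine Finset.sum_congr rfl fun k _ => ?_
    rw [hpoch, hrec]
    field_simp
  rwa [hval]

/-- Functions on the half planes `1 - K < Re s` that agree for `1 < Re s` are the restrictions of
one entire function. -/
theorem exists_entire_of_halfPlanes {f : ℕ → ℂ → ℂ}
    (hd : ∀ K : ℕ, DifferentiableOn ℂ (f K) {s : ℂ | 1 - (K : ℝ) < s.re})
    (heq : ∀ (K L : ℕ) (s : ℂ), 1 < s.re → f K s = f L s) :
    ∃ F : ℂ → ℂ, Differentiable ℂ F ∧ ∀ K : ℕ, EqOn F (f K) {s : ℂ | 1 - (K : ℝ) < s.re} := by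
  have hopen : ∀ a : ℝ, IsOpen {s : ℂ | a < s.re} := fun a =>
    isOpen_lt continuous_const Complex.continuous_re
  have hcompat : ∀ (K L : ℕ) (s : ℂ), 1 - (K : ℝ) < s.re → 1 - (L : ℝ) < s.re →
      f K s = f L s := by
    intro K L s hK hL
    have hsub : ∀ M : ℕ, 1 - (M : ℝ) ≤ max (1 - (K : ℝ)) (1 - L) →
        AnalyticOnNhd ℂ (f M) {s : ℂ | max (1 - (K : ℝ)) (1 - L) < s.re} := fun M hM =>
      ((hd M).mono fun s hs => lt_of_le_of_lt hM hs).analyticOnNhd (hopen _)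
    refine (hsub K (le_max_left _ _)).eqOn_of_preconnected_of_eventuallyEq
      (hsub L (le_max_right _ _)) (convex_halfSpace_re_gt _).isPreconnected (z₀ := 2) ?_ ?_
      (max_lt hK hL)
    · have h1 : (0 : ℝ) ≤ K := K.cast_nonneg
      have h2 : (0 : ℝ) ≤ L := L.cast_nonneg
      refine max_lt (a := (2 : ℂ).re) ?_ ?_ <;> simp <;> linarith
    · filter_upwards [(hopen 1).mem_nhds (show (1 : ℝ) < (2 : ℂ).re by simp)] with s hs
      exact heq K L s hs
  choose N hN using fun s : ℂ => exists_nat_gt (1 - s.re)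
  have hF : ∀ K : ℕ, EqOn (fun s => f (N s) s) (f K) {s : ℂ | 1 - (K : ℝ) < s.re} :=
    fun K s hs => hcompat _ _ s (by linarith [hN s]) hs
  refine ⟨fun s => f (N s) s, fun s => ?_, hF⟩
  have hmem : {t : ℂ | 1 - (N s : ℝ) < t.re} ∈ 𝓝 s :=
    (hopen _).mem_nhds (show 1 - (N s : ℝ) < s.re by linarith [hN s])
  exact ((hd (N s)).differentiableAt hmem).congr_of_eventuallyEq
    ((hF (N s)).eventuallyEq_of_mem hmem)

/-- The continuation exists, and for `-2 < Re s` it is the one obtained by subtracting the three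
explicit terms `1, u / 2, u² / 12`. -/
theorem exists_isHurwitzZeta {ν : ℂ} (hν : 0 < ν.re) : ∃ Z : ℂ → ℂ, IsHurwitzZeta ν Z ∧
    ∀ s : ℂ, -2 < s.re → Z s = hurwitzReg toddCoeff 3 ν s / (s - 1) := by
  -- any expansion of order `K` will do, but at `K = 3` the explicit one is singled out
  have hex : ∀ K : ℕ, ∃ c : ℕ → ℝ,
      ((fun u => todd u - ∑ k ∈ Finset.range K, c k * u ^ k) =O[𝓝[>] 0] fun u => u ^ K) ∧
      (K = 3 → c = toddCoeff) := by
    intro K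
    by_cases hK : K = 3
    · subst hK
      exact ⟨toddCoeff, todd_sub_sum_toddCoeff_isBigO, fun _ => rfl⟩
    · obtain ⟨c, hc⟩ := exists_todd_sub_sum_isBigO K
      exact ⟨c, hc, fun h => absurd h hK⟩
  choose c hc hc3 using hex
  obtain ⟨F, hFd, hF⟩ := exists_entire_of_halfPlanes
    (f := fun K => hurwitzReg (c K) K ν) (fun K => differentiableOn_hurwitzReg hν (hc K)) (by
      intro K L s hs
      have hs1 : s - 1 ≠ 0 := fun h => by
        have := congrArg Complex.re h
        simp at this; linarith
      have := (hasSum_hurwitzReg (c K) K hν hs).unique (hasSum_hurwitzReg (c L) L hν hs)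
      exact (div_left_inj' hs1).1 this)
  refine ⟨fun s => F s / (s - 1), ⟨fun s hs => ?_, fun s hs => ?_⟩, fun s hs => ?_⟩
  · exact (DifferentiableAt.fun_div (hFd s) (by fun_prop : DifferentiableAt ℂ (fun s : ℂ => s - 1) s)
      (sub_ne_zero.2 hs)).differentiableWithinAt
  · have h0 := hasSum_hurwitzReg (c 0) 0 hν hs
    rwa [← hF 0 (show 1 - ((0 : ℕ) : ℝ) < s.re by simp; linarith)] at h0
  · have := hF 3 (show 1 - ((3 : ℕ) : ℝ) < s.re by norm_num; linarith)
    simp only [this, hc3 3 rfl]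

theorem isHurwitzZeta_hurwitzZeta {ν : ℂ} (hν : 0 < ν.re) :
    IsHurwitzZeta ν (fun s => hurwitzZeta s ν) := by
  obtain ⟨Z, hZ, -⟩ := exists_isHurwitzZeta hν
  have h : ∃ Z, IsHurwitzZeta ν Z := ⟨Z, hZ⟩
  have : (fun s => hurwitzZeta s ν) = h.choose := funext fun s => by rw [hurwitzZeta, dif_pos h]
  rw [this]
  exact h.choose_spec

/-! ### The derivative at `s = -1` -/

theorem hasDerivAt_inv_Gamma_neg_one :
    HasDerivAt (fun s : ℂ => (Complex.Gamma s)⁻¹) (-1) (-1) := by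
  have h : (fun s : ℂ => (Complex.Gamma s)⁻¹) =
      fun s => (s + 1) * (s * (Complex.Gamma (s + 1 + 1))⁻¹) := by
    funext s
    rw [Complex.one_div_Gamma_eq_self_mul_one_div_Gamma_add_one s,
      Complex.one_div_Gamma_eq_self_mul_one_div_Gamma_add_one (s + 1)]
    ring
  have hd : DifferentiableAt ℂ (fun s : ℂ => s * (Complex.Gamma (s + 1 + 1))⁻¹) (-1) :=
    differentiableAt_id.mul ((Complex.differentiable_one_div_Gamma _).comp (-1 : ℂ)
      (f := fun s : ℂ => s + 1 + 1) (by fun_prop))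
  rw [h]
  have := ((hasDerivAt_id (-1 : ℂ)).add_const 1).mul hd.hasDerivAt
  refine this.congr_deriv ?_
  simp

/-- Since `1 / Γ` has a simple zero with derivative `-1` at `-1`, only the value, not the derivative,
of the Mellin transform enters. -/
theorem hurwitzZetaDeriv_neg_one {ν : ℂ} (hν : 0 < ν.re) :
    hurwitzZetaDeriv (-1) ν = -mellin (toddRem toddCoeff 3 ν) (-1) +
      (ν ^ 2 / 2 - ν / 2 + 1 / 12) * Complex.log ν - ν ^ 2 / 4 + 1 / 12 := by
  have hν0 : ν ≠ 0 := by rintro rfl; simp at hν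
  obtain ⟨Z, hZ, hZ3⟩ := exists_isHurwitzZeta hν
  have hev : (fun s => hurwitzZeta s ν) =ᶠ[𝓝 (-1)] fun s =>
      (Complex.Gamma s)⁻¹ * mellin (toddRem toddCoeff 3 ν) s + (ν ^ (1 - s) / (s - 1) +
        (1 / 2 * ν ^ (-s) + 1 / 12 * (s * ν ^ (-1 - s)))) := by
    have h1 : {s : ℂ | -2 < s.re} ∈ 𝓝 (-1 : ℂ) :=
      (isOpen_lt continuous_const Complex.continuous_re).mem_nhds (by simp)
    have h2 : ({1}ᶜ : Set ℂ) ∈ 𝓝 (-1 : ℂ) := isOpen_compl_singleton.mem_nhds (by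
      simp only [mem_compl_iff, mem_singleton_iff]; norm_num)
    filter_upwards [h1, h2] with s hs hs1
    have hs1' : s - 1 ≠ 0 := sub_ne_zero.2 hs1
    have hH : hurwitzZeta s ν = Z s := (isHurwitzZeta_hurwitzZeta hν).eqOn hZ hs1
    rw [hH, hZ3 s hs, hurwitzReg, add_div,
      mul_div_cancel_left₀ _ hs1']
    congr 1
    have e1 : 1 - s - ((1 : ℕ) : ℂ) = -s := by push_cast; ring
    have e2 : 1 - s - ((2 : ℕ) : ℂ) = -1 - s := by push_cast; ring
    simp only [Finset.sum_range_succ, Finset.range_zero, Finset.sum_empty, e1, e2]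
    simp [toddCoeff, ascPochhammer_succ_right]
    field_simp
    ring
  rw [hurwitzZetaDeriv, hev.deriv_eq]
  have hM : DifferentiableAt ℂ (mellin (toddRem toddCoeff 3 ν)) (-1) :=
    differentiableAt_mellin_toddRem hν todd_sub_sum_toddCoeff_isBigO (by norm_num)
  have hpow : ∀ a : ℂ, HasDerivAt (fun s : ℂ => ν ^ (a - s))
      (ν ^ (a - -1) * Complex.log ν * (-1)) (-1) := fun a =>
    HasDerivAt.const_cpow ((hasDerivAt_id (-1 : ℂ)).const_sub a) (Or.inl hν0)
  have hp0 : HasDerivAt (fun s : ℂ => ν ^ (-s)) (ν ^ (- -1 : ℂ) * Complex.log ν * (-1)) (-1) :=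
    HasDerivAt.const_cpow ((hasDerivAt_id (-1 : ℂ)).neg) (Or.inl hν0)
  have hall := (hasDerivAt_inv_Gamma_neg_one.mul hM.hasDerivAt).add
    (((hpow 1).div ((hasDerivAt_id (-1 : ℂ)).sub_const 1) (by norm_num)).add
      ((hp0.const_mul (1 / 2)).add
        (((hasDerivAt_id (-1 : ℂ)).mul (hpow (-1))).const_mul (1 / 12))))
  refine hall.deriv.trans ?_
  have hG : Complex.Gamma (-1) = 0 := by simpa using Complex.Gamma_neg_nat_eq_zero 1
  have e2 : (1 : ℂ) - -1 = ((2 : ℕ) : ℂ) := by norm_num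
  simp only [hG, e2, Complex.cpow_natCast, id, neg_neg, Complex.cpow_one, sub_self,
    Complex.cpow_zero, inv_zero]
  norm_num
  ring

/-! ### The oscillatory part of the integral -/

/-- The difference between the two subtractions in use,
`e^{-zu} (1/u³ - 1/(24 u)) - e^{-(z+1/2)u} (1/u³ + 1/(2 u²) + 1/(12 u))`, written as a
superposition of exponentials (see `oscillatoryPart_eq`). This form has no singularity at `u = 0`,
and Fubini's theorem computes its integral over `[0, T]`. -/
noncomputable def oscillatoryPart (z : ℂ) (u : ℝ) : ℂ :=
  ∫ t in (0 : ℝ)..1 / 2, ((t : ℂ) ^ 2 / 2 - 1 / 24) * Complex.exp (-(z + t) * u)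

theorem oscillatoryPart_eq (z : ℂ) {u : ℝ} (hu : u ≠ 0) :
    oscillatoryPart z u = Complex.exp (-z * u) * (1 / (u : ℂ) ^ 3 - 1 / (24 * u)) -
      Complex.exp (-(z + 1 / 2) * u) * (1 / (u : ℂ) ^ 3 + 1 / (2 * (u : ℂ) ^ 2) + 1 / (12 * u)) := by
  have huc : (u : ℂ) ≠ 0 := by exact_mod_cast hu
  have hder : ∀ t : ℝ, HasDerivAt (fun t : ℝ => Complex.exp (-(z + t) * u) *
      (-((t : ℂ) ^ 2 / 2 - 1 / 24) / u - t / (u : ℂ) ^ 2 - 1 / (u : ℂ) ^ 3))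
      (((t : ℂ) ^ 2 / 2 - 1 / 24) * Complex.exp (-(z + t) * u)) t := by
    intro t
    have ht : HasDerivAt (fun t : ℝ => (t : ℂ)) 1 t := Complex.ofRealCLM.hasDerivAt
    have h1 : HasDerivAt (fun t : ℝ => Complex.exp (-(z + t) * u))
        (Complex.exp (-(z + t) * u) * (-1 * u)) t := ((ht.const_add z).fun_neg.mul_const _).cexp
    have h2 : HasDerivAt (fun t : ℝ => -((t : ℂ) ^ 2 / 2 - 1 / 24) / u - t / (u : ℂ) ^ 2 -
        1 / (u : ℂ) ^ 3) (-(t : ℂ) / u - 1 / (u : ℂ) ^ 2) t := by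
      have h3 := (((((ht.fun_pow 2).div_const 2).sub_const (1 / 24)).fun_neg.div_const
        (u : ℂ)).fun_sub
        (ht.div_const ((u : ℂ) ^ 2))).sub_const (1 / (u : ℂ) ^ 3)
      refine h3.congr_deriv ?_
      simp
    refine (h1.mul h2).congr_deriv ?_
    field_simp
    ring
  rw [oscillatoryPart, intervalIntegral.integral_eq_sub_of_hasDerivAt (fun t _ => hder t)
    (Continuous.intervalIntegrable (by fun_prop) _ _)]
  push_cast
  rw [add_zero]
  field_simp
  ring

theorem continuous_oscillatoryPart (z : ℂ) : Continuous (oscillatoryPart z) := by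
  unfold oscillatoryPart
  refine intervalIntegral.continuous_parametric_intervalIntegral_of_continuous' ?_ _ _
  fun_prop

theorem integral_oscillatoryPart {z : ℂ} (hz : z.im ≠ 0) (T : ℝ) :
    ∫ u in (0 : ℝ)..T, oscillatoryPart z u = ∫ t in (0 : ℝ)..1 / 2,
      ((t : ℂ) ^ 2 / 2 - 1 / 24) / (z + t) * (1 - Complex.exp (-(z + t) * T)) := by
  unfold oscillatoryPart
  rw [intervalIntegral_intervalIntegral_swap]
  · refine intervalIntegral.integral_congr fun t _ => ?_
    have hne : z + t ≠ 0 := fun h => hz (by simpa using congrArg Complex.im h)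
    rw [intervalIntegral.integral_const_mul, integral_exp_mul_complex (neg_ne_zero.2 hne)]
    simp only [Complex.ofReal_zero, mul_zero, Complex.exp_zero]
    field_simp
    ring
  · have hc : Continuous (Function.uncurry fun (u t : ℝ) =>
        ((t : ℂ) ^ 2 / 2 - 1 / 24) * Complex.exp (-(z + t) * u)) := by fun_prop
    refine (hc.continuousOn.integrableOn_compact
      ((isCompact_uIcc (a := (0 : ℝ)) (b := T)).prod
        (isCompact_uIcc (a := (0 : ℝ)) (b := 1 / 2)))).mono_set ?_
    exact prod_mono uIoc_subset_uIcc uIoc_subset_uIcc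

theorem continuous_div_add_ofReal {z : ℂ} (hz : z.im ≠ 0) :
    Continuous fun t : ℝ => ((t : ℂ) ^ 2 / 2 - 1 / 24) / (z + t) := by
  refine Continuous.div (by fun_prop) (by fun_prop) fun t h => hz ?_
  simpa using congrArg Complex.im h

/-- For `Re z = 0` the exponential `e^{-(z + t)T}` still tends to `0` for every `t > 0`, so the limit
passes under the integral over `t` by dominated convergence, no matter how slowly the integral over
`u` converges. -/
theorem tendsto_integral_oscillatoryPart {z : ℂ} (hz : z.im ≠ 0) (hz0 : 0 ≤ z.re) :
    Tendsto (fun T : ℝ => ∫ u in (0 : ℝ)..T, oscillatoryPart z u) atTop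
      (𝓝 (∫ t in (0 : ℝ)..1 / 2, ((t : ℂ) ^ 2 / 2 - 1 / 24) / (z + t))) := by
  simp only [integral_oscillatoryPart hz]
  have hcont := continuous_div_add_ofReal hz
  refine intervalIntegral.tendsto_integral_filter_of_dominated_convergence
    (fun t : ℝ => ‖((t : ℂ) ^ 2 / 2 - 1 / 24) / (z + t)‖ * 2) ?_ ?_
    ((hcont.norm.mul continuous_const).intervalIntegrable _ _) ?_
  · refine Eventually.of_forall fun T => Continuous.aestronglyMeasurable ?_
    exact hcont.mul (by fun_prop)
  · filter_upwards [eventually_ge_atTop 0] with T hT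
    refine Eventually.of_forall fun t ht => ?_
    rw [uIoc_of_le (by norm_num)] at ht
    rw [norm_mul]
    gcongr
    refine (norm_sub_le _ _).trans ?_
    rw [norm_cexp_neg_mul_ofReal, norm_one]
    have : Real.exp (-(z + t).re * T) ≤ 1 := by
      rw [Real.exp_le_one_iff, Complex.add_re, Complex.ofReal_re]
      nlinarith [ht.1, mul_nonneg hz0 hT, mul_nonneg ht.1.le hT]
    linarith
  · refine Eventually.of_forall fun t ht => ?_
    rw [uIoc_of_le (by norm_num)] at ht
    have hpos : 0 < (z + t).re := by
      rw [Complex.add_re, Complex.ofReal_re]; linarith [ht.1]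
    have hexp : Tendsto (fun T : ℝ => Complex.exp (-(z + t) * T)) atTop (𝓝 0) := by
      rw [tendsto_zero_iff_norm_tendsto_zero]
      simp only [norm_cexp_neg_mul_ofReal]
      simp only [neg_mul]
      exact Real.tendsto_exp_neg_atTop_nhds_zero.comp (tendsto_id.const_mul_atTop hpos)
    simpa using (hexp.const_sub 1).const_mul (((t : ℂ) ^ 2 / 2 - 1 / 24) / (z + t))

theorem integral_div_add_ofReal {z : ℂ} (hz : z.im ≠ 0) :
    ∫ t in (0 : ℝ)..1 / 2, ((t : ℂ) ^ 2 / 2 - 1 / 24) / (z + t) =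
      1 / 16 - z / 4 + (z ^ 2 / 2 - 1 / 24) * (Complex.log (z + 1 / 2) - Complex.log z) := by
  have hder : ∀ t : ℝ, HasDerivAt (fun t : ℝ => (t : ℂ) ^ 2 / 4 - z * t / 2 +
      (z ^ 2 / 2 - 1 / 24) * Complex.log (z + t)) (((t : ℂ) ^ 2 / 2 - 1 / 24) / (z + t)) t := by
    intro t
    have hne : z + t ≠ 0 := fun h => hz (by simpa using congrArg Complex.im h)
    have ht : HasDerivAt (fun t : ℝ => (t : ℂ)) 1 t := Complex.ofRealCLM.hasDerivAt
    have hlog : HasDerivAt (fun t : ℝ => Complex.log (z + t)) (1 / (z + t)) t :=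
      (ht.const_add z).clog_real (Or.inr (by simpa using hz))
    have h := (((ht.fun_pow 2).div_const 4).fun_sub ((ht.const_mul z).div_const 2)).fun_add
      (hlog.const_mul (z ^ 2 / 2 - 1 / 24))
    refine h.congr_deriv ?_
    field_simp
    push_cast
    ring
  rw [intervalIntegral.integral_eq_sub_of_hasDerivAt (fun t _ => hder t)
    ((continuous_div_add_ofReal hz).intervalIntegrable _ _)]
  push_cast
  rw [add_zero]
  ring

/-! ### The improper integral -/

/-- The electric integrand in the variable `u = 2 √κ τ`, where `e^{-iτ} = e^{-zu}` with
`z = i / (2 √κ)`. -/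
noncomputable def scaledIntegrand (z : ℂ) (u : ℝ) : ℂ :=
  Complex.exp (-z * u) / (u : ℂ) ^ 3 * ((u / 2 * csch (u / 2) - 1 + u ^ 2 / 24 : ℝ) : ℂ)

/-- The integrand is the sum of an absolutely integrable part, which is the Mellin integrand of
`toddRem` at `s = -1`, and of an elementary oscillatory part. -/
theorem scaledIntegrand_eq (z : ℂ) {u : ℝ} (hu : 0 < u) :
    scaledIntegrand z u = (u : ℂ) ^ ((-1 : ℂ) - 1) • toddRem toddCoeff 3 (z + 1 / 2) u -
      oscillatoryPart z u := by
  have huc : (u : ℂ) ≠ 0 := by exact_mod_cast hu.ne'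
  rw [oscillatoryPart_eq z hu.ne', scaledIntegrand, toddRem, sum_toddCoeff]
  have hpow : (u : ℂ) ^ ((-1 : ℂ) - 1) = ((u : ℂ) ^ 2)⁻¹ := by
    rw [show (-1 : ℂ) - 1 = -((2 : ℕ) : ℂ) by norm_num, Complex.cpow_neg, Complex.cpow_natCast]
  have hE0 : Real.exp (-(u / 2)) ≠ 0 := (Real.exp_pos _).ne'
  have hE1 : 1 - Real.exp (-(u / 2)) ^ 2 ≠ 0 := by
    have := (one_sub_exp_neg_pos hu).ne'
    rwa [show -u = ((2 : ℕ) : ℝ) * -(u / 2) by push_cast; ring, Real.exp_nat_mul] at this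
  have hcsch : csch (u / 2) = 2 * Real.exp (-(u / 2)) / (1 - Real.exp (-(u / 2)) ^ 2) := by
    have h2 : Real.exp (u / 2) = (Real.exp (-(u / 2)))⁻¹ := by rw [← Real.exp_neg, neg_neg]
    rw [csch, Real.sinh_eq, h2]
    field_simp
  have htodd : todd u = u / (1 - Real.exp (-(u / 2)) ^ 2) := by
    rw [todd, show -u = ((2 : ℕ) : ℝ) * -(u / 2) by push_cast; ring, Real.exp_nat_mul]
  have hexp : Complex.exp (-(z + 1 / 2) * u) =
      Complex.exp (-z * u) * ((Real.exp (-(u / 2)) : ℝ) : ℂ) := by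
    rw [Complex.ofReal_exp, ← Complex.exp_add]; congr 1; push_cast; ring
  rw [hpow, hcsch, htodd, hexp]
  -- with `E = e^{-u/2}` the identity is one of rational functions
  generalize Real.exp (-(u / 2)) = E at *
  have hE1c : 1 - (E : ℂ) ^ 2 ≠ 0 := by exact_mod_cast hE1
  push_cast
  rw [smul_eq_mul]
  field_simp
  ring

theorem hasImproperIntegral_scaledIntegrand {z : ℂ} (hz : z.im ≠ 0) (hz0 : 0 ≤ z.re) :
    HasImproperIntegral (scaledIntegrand z) (mellin (toddRem toddCoeff 3 (z + 1 / 2)) (-1) -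
      (1 / 16 - z / 4 + (z ^ 2 / 2 - 1 / 24) * (Complex.log (z + 1 / 2) - Complex.log z))) := by
  have hM : IntegrableOn (fun u : ℝ => (u : ℂ) ^ ((-1 : ℂ) - 1) •
      toddRem toddCoeff 3 (z + 1 / 2) u) (Ioi 0) :=
    mellinConvergent_toddRem (by simp; linarith) todd_sub_sum_toddCoeff_isBigO (by norm_num)
  have hMT : ∀ T : ℝ, 0 ≤ T → IntervalIntegrable (fun u : ℝ => (u : ℂ) ^ ((-1 : ℂ) - 1) •
      toddRem toddCoeff 3 (z + 1 / 2) u) volume 0 T := fun T hT =>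
    (intervalIntegrable_iff_integrableOn_Ioc_of_le hT).2 (hM.mono_set Ioc_subset_Ioi_self)
  have hST : ∀ T : ℝ, IntervalIntegrable (oscillatoryPart z) volume 0 T := fun T =>
    (continuous_oscillatoryPart z).intervalIntegrable _ _
  refine ⟨fun T hT => ((hMT T hT).sub (hST T)).congr fun u hu => ?_, ?_⟩
  · rw [uIoc_of_le hT] at hu
    exact (scaledIntegrand_eq z hu.1).symm
  · have h := (intervalIntegral_tendsto_integral_Ioi 0 hM tendsto_id).sub
      (tendsto_integral_oscillatoryPart hz hz0)
    rw [integral_div_add_ofReal hz] at h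
    refine h.congr' ?_
    filter_upwards [eventually_ge_atTop 0] with T hT
    rw [id, ← intervalIntegral.integral_sub (hMT T hT) (hST T)]
    refine intervalIntegral.integral_congr_uIoo fun u hu => ?_
    rw [uIoo_of_le hT] at hu
    exact (scaledIntegrand_eq z hu.1).symm

theorem HasImproperIntegral.comp_mul_left {g : ℝ → ℂ} {I : ℂ} (h : HasImproperIntegral g I)
    {b : ℝ} (hb : 0 < b) (C : ℂ) :
    HasImproperIntegral (fun τ => C * g (b * τ)) (C * ((b⁻¹ : ℝ) * I)) := by
  refine ⟨fun T hT => ?_, ?_⟩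
  · have := ((h.1 (b * T) (by positivity)).comp_mul_left (c := b)).const_mul C
    simpa [hb.ne'] using this
  · have hT : Tendsto (fun T : ℝ => b * T) atTop atTop := tendsto_id.const_mul_atTop hb
    refine (((h.2.comp hT).const_mul ((b⁻¹ : ℝ) : ℂ)).const_mul C).congr fun T => ?_
    rw [intervalIntegral.integral_const_mul, intervalIntegral.integral_comp_mul_left _ hb.ne']
    simp

theorem electricIntegrand_eq {κ : ℝ} (hκ : 0 < κ) (τ : ℝ) :
    electricIntegrand κ τ = ((2 * √κ : ℝ) : ℂ) ^ 3 *
      scaledIntegrand (Complex.I / (2 * (√κ : ℂ))) (2 * √κ * τ) := by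
  have hs : 0 < √κ := Real.sqrt_pos.2 hκ
  have hsc : (√κ : ℂ) ≠ 0 := by exact_mod_cast hs.ne'
  have h1 : 2 * √κ * τ / 2 = √κ * τ := by ring
  have h2 : (2 * √κ * τ) ^ 2 / 24 = κ * τ ^ 2 / 6 := by
    rw [mul_pow, mul_pow, Real.sq_sqrt hκ.le]; ring
  have h3 : -(Complex.I / (2 * (√κ : ℂ))) * ((2 * √κ * τ : ℝ) : ℂ) = -Complex.I * τ := by
    push_cast; field_simp
  rw [electricIntegrand, scaledIntegrand, h1, h2, h3]
  rcases eq_or_ne τ 0 with rfl | hτ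
  · simp
  · have hτc : (τ : ℂ) ≠ 0 := by exact_mod_cast hτ
    push_cast
    field_simp

end HeisenbergEuler

theorem mainTheorem4 (κ : ℝ) (hκ : 0 < κ) :
    (∃ I : ℂ, HeisenbergEuler.HasImproperIntegral (HeisenbergEuler.electricIntegrand κ) I) ∧
    HeisenbergEuler.IsHurwitzZeta (((√κ : ℂ) + Complex.I) / (2 * (√κ : ℂ)))
      (fun s => HeisenbergEuler.hurwitzZeta s (((√κ : ℂ) + Complex.I) / (2 * (√κ : ℂ)))) ∧
    HeisenbergEuler.electricF κ =
      (κ : ℂ) / 6 - 1 / 4 - ((κ : ℂ) / 6 + 1 / 2) * (Real.log (2 * √κ) : ℂ)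
        + Complex.I * ((Real.pi : ℂ) / 4 + (κ : ℂ) * (Real.pi : ℂ) / 12)
        + 4 * (κ : ℂ) * HeisenbergEuler.hurwitzZetaDeriv (-1)
            (((√κ : ℂ) + Complex.I) / (2 * (√κ : ℂ))) := by
  have hs : 0 < √κ := Real.sqrt_pos.2 hκ
  have hsc : (√κ : ℂ) ≠ 0 := by exact_mod_cast hs.ne'
  have hsq : (√κ : ℂ) ^ 2 = κ := by exact_mod_cast Real.sq_sqrt hκ.le
  have hκc : (κ : ℂ) ≠ 0 := by exact_mod_cast hκ.ne'
  have hb : 0 < 2 * √κ := by positivity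
  obtain ⟨z, hz⟩ : ∃ z : ℂ, z = Complex.I / (2 * (√κ : ℂ)) := ⟨_, rfl⟩
  have hz' : z = (((2 * √κ)⁻¹ : ℝ) : ℂ) * Complex.I := by
    rw [hz]; push_cast; field_simp
  have hre : z.re = 0 := by rw [hz']; simp
  have him : z.im ≠ 0 := by
    rw [hz']
    simpa using hs.ne'
  have hν : ((√κ : ℂ) + Complex.I) / (2 * (√κ : ℂ)) = z + 1 / 2 := by
    rw [hz]; field_simp; ring
  have hνre : 0 < (z + 1 / 2).re := by simp [hre]
  have hlog : Complex.log z = -(Real.log (2 * √κ) : ℂ) + Real.pi / 2 * Complex.I := by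
    rw [hz', Complex.log_ofReal_mul (inv_pos.2 hb) Complex.I_ne_zero, Complex.log_I, Real.log_inv]
    push_cast; ring
  have hzsq : (κ : ℂ) * z ^ 2 = -1 / 4 := by
    rw [hz, div_pow, mul_pow, hsq, Complex.I_sq]; field_simp; norm_num
  have hI := (HeisenbergEuler.hasImproperIntegral_scaledIntegrand him hre.ge).comp_mul_left hb
    (((2 * √κ : ℝ) : ℂ) ^ 3)
  rw [hz, ← funext (HeisenbergEuler.electricIntegrand_eq hκ), ← hz] at hI
  refine ⟨⟨_, hI⟩, ?_, ?_⟩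
  · rw [hν]
    exact HeisenbergEuler.isHurwitzZeta_hurwitzZeta hνre
  · rw [HeisenbergEuler.electricF, hI.improperIntegral_eq, hν,
      HeisenbergEuler.hurwitzZetaDeriv_neg_one hνre, hlog]
    have hscale : ((2 * √κ : ℝ) : ℂ) ^ 3 * (((2 * √κ)⁻¹ : ℝ) : ℂ) = 4 * κ := by
      rw [← hsq]; push_cast; field_simp; norm_num
    rw [← mul_assoc, hscale]
    -- the logarithms of `ν` and the Mellin transforms cancel; what is left is `κ z² = -1 / 4`
    linear_combination (1 + 2 * (Real.log (2 * √κ) : ℂ) - Real.pi * Complex.I) * hzsq
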